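/- Let $\Phi$ be a real $n\times N$ matrix. For real $s\ge 0$ let $\Sigma_s$ be the set of $x\in\mathbb R^N$ with at most $s$ nonzero entries, and let $\delta_s$ be the smallest $d\ge 0$ such that $(1-d)\|x\|_2^2\le\|\Phi x\|_2^2\le(1+d)\|x\|_2^2$ for all $x\in\Sigma_s$. For an integer $k\ge1$ put $\sigma_k(x)_p=\min_{z\in\Sigma_k}\|x-z\|_p$. For $y\in\mathbb R^n$ let $\mathrm{OMP}_M(y)$ be the output $c^M$ of $M$ iterations of Orthogonal Matching Pursuit: $c^0=0$, $\Lambda^0=\emptyset$ and, for $0\le\ell<M$, $\Lambda^{\ell+1}=\Lambda^\ell\cup\{j\}$ where $j$ maximizes $|(\Phi^T(y-\Phi c^\ell))_j|$, and $c^{\ell+1}$ minimizes $\|y-\Phi z\|_2$ among all $z$ supported in $\Lambda^{\ell+1}$ (ties are broken arbitrarily). **Theorem.** Let $k\ge 1$ be an integer, $1\le p\le q\le 2$ with $p\ne2$, $0<\delta\le1$, $\alpha=\lceil16+15\delta\rceil$ and $L=k(N/k)^{2-2/p}$. Suppose that $\delta_L<\delta$ and that $\delta_{2k}+(1+\delta)\,\delta_{2\alpha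 k}\le\delta$. Then for every $x\in\mathbb R^N$, every $\varepsilon$ and every $e\in\mathbb R^n$ with $\|e\|_2\le\varepsilon$, every output $x^*=\mathrm{OMP}_{2(\alpha-1)k}(\Phi x+e)$ satisfies $$\|x^*-x\|_q\le C_0\,\frac{\sigma_k(x)_p}{k^{1/p-1/q}}+C_1\,k^{1/q-1/2}\,\varepsilon,$$ where $C_1=(2\alpha)^{1/q-1/2}\bigl(2(1+\delta)(\sqrt{11+20\delta}+1)+1\bigr)$ and $C_0=1+C_1+(2\alpha)^{1/q-1/2}$. -/

import Mathlib

/-- The `ℓ_p` norm of a vector of `ℝ^m`. -/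
noncomputable def ellNorm {m : ℕ} (p : ℝ) (x : Fin m → ℝ) : ℝ :=
  ‖WithLp.toLp (ENNReal.ofReal p) x‖

/-- For `0 < p`, `ellNorm p` is given by the usual formula. -/
theorem ellNorm_eq_sum {m : ℕ} {p : ℝ} (hp : 0 < p) (x : Fin m → ℝ) :
    ellNorm p x = (∑ i, |x i| ^ p) ^ (1 / p) := by
  have h : (ENNReal.ofReal p).toReal = p := ENNReal.toReal_ofReal hp.le
  unfold ellNorm
  rw [PiLp.norm_eq_sum (by rw [h]; exact hp)]
  simp [h]

/-- The set `Σ_s` of vectors with at most `s` nonzero entries (`s` may be any real number). -/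
def sparseVectors (N : ℕ) (s : ℝ) : Set (Fin N → ℝ) :=
  {x | (hammingNorm x : ℝ) ≤ s}

/-- The best `k`-term approximation error `σ_k(x)_p`, the distance in `ℓ_p` from `x` to `Σ_k`. -/
noncomputable def bestTermError {N : ℕ} (p : ℝ) (k : ℕ) (x : Fin N → ℝ) : ℝ :=
  sInf ((fun z => ellNorm p (x - z)) '' sparseVectors N k)

/-- The restricted isometry inequalities of order `s` with constant `d`. -/
def RestrictedIsometry {n N : ℕ} (Φ : Matrix (Fin n) (Fin N) ℝ) (s d : ℝ) : Prop :=
  ∀ x ∈ sparseVectors N s,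
    (1 - d) * ellNorm 2 x ^ 2 ≤ ellNorm 2 (Φ.mulVec x) ^ 2 ∧
      ellNorm 2 (Φ.mulVec x) ^ 2 ≤ (1 + d) * ellNorm 2 x ^ 2

/-- The restricted isometry constant `δ_s` of `Φ`: the least nonnegative constant for which the
restricted isometry inequalities of order `s` hold. -/
noncomputable def ripConst {n N : ℕ} (Φ : Matrix (Fin n) (Fin N) ℝ) (s : ℝ) : ℝ :=
  sInf {d : ℝ | 0 ≤ d ∧ RestrictedIsometry Φ s d}

/-- `RIP(s, δ)`: the restricted isometry constant of order `s` is smaller than `δ`. -/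
def RIP {n N : ℕ} (Φ : Matrix (Fin n) (Fin N) ℝ) (s δ : ℝ) : Prop :=
  ripConst Φ s < δ

/-- `OMPState Φ y ℓ Λ c` says that Orthogonal Matching Pursuit with input `y` can be, after `ℓ`
iterations, in the state with index set `Λ` and iterate `c`. Any tie in the choice of the index
`j`, and any choice among least-squares minimizers, is allowed. -/
inductive OMPState {n N : ℕ} (Φ : Matrix (Fin n) (Fin N) ℝ) (y : Fin n → ℝ) :
    ℕ → Finset (Fin N) → (Fin N → ℝ) → Prop
  | init : OMPState Φ y 0 ∅ 0
  | step {l : ℕ} {Λ : Finset (Fin N)} {c : Fin N → ℝ} (j : Fin N) (c' : Fin N → ℝ)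
      (prev : OMPState Φ y l Λ c)
      (identify : ∀ i : Fin N, |Φ.transpose.mulVec (y - Φ.mulVec c) i| ≤
        |Φ.transpose.mulVec (y - Φ.mulVec c) j|)
      (supported : ∀ i, i ∉ insert j Λ → c' i = 0)
      (update : ∀ z : Fin N → ℝ, (∀ i, i ∉ insert j Λ → z i = 0) →
        ellNorm 2 (y - Φ.mulVec c') ≤ ellNorm 2 (y - Φ.mulVec z)) :
      OMPState Φ y (l + 1) (insert j Λ) c'

/-- `xs` is an output of Orthogonal Matching Pursuit with input `y` and `M` iterations. -/
def IsOMPOutput {n N : ℕ} (Φ : Matrix (Fin n) (Fin N) ℝ) (M : ℕ) (y : Fin n → ℝ)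
    (xs : Fin N → ℝ) : Prop :=
  ∃ Λ : Finset (Fin N), OMPState Φ y M Λ xs

/-- The number `α = ⌈16 + 15 δ⌉`. -/
noncomputable def ompAlpha (δ : ℝ) : ℕ := ⌈16 + 15 * δ⌉₊

/-- The constant `C₁`. -/
noncomputable def ompC1 (δ q : ℝ) : ℝ :=
  (2 * (ompAlpha δ : ℝ)) ^ (1 / q - 1 / 2) *
    (2 * (1 + δ) * (√(11 + 20 * δ) + 1) + 1)

/-- The constant `C₀`. -/
noncomputable def ompC0 (δ q : ℝ) : ℝ :=
  1 + ompC1 δ q + (2 * (ompAlpha δ : ℝ)) ^ (1 / q - 1 / 2)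

/-! Split `x = u + w`, where `u` keeps at most `2k` entries (the support of a `k`-sparse competitor
`z` and the `k` largest entries outside it). OMP on `Φ x + e` is then OMP on the sparse vector `u`
with noise `e' = Φ w + e`, so two estimates suffice.

Noise: cutting `w` into blocks of `⌊L⌋` decreasing entries and using the isometry on each block
gives `‖Φ w‖₂ ≲ ‖w‖₂ + ‖w‖₁ / √⌊L⌋`; `L` is chosen so that both terms are of order `k^(1/2-1/p) ‖x -
z‖_p` (`ellNorm_mulVec_tail_le`).

Sparse recovery: one OMP step shrinks the excess of the squared residual over that of any target `v`
by a factor `1 - (lo/up)/t`, where `t` bounds the number of indices of `v` not yet selected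
(`residualEnergy_greedy_step`). Targets missing `1, 3, 7, …` indices are chased in turn, up to a
scale `2^b` at which the energy of `u` outside the target stops dropping quickly. After `A 2^b`
further steps, either the squared residual is at most `11 ‖e'‖²`, or at least `2^b` new indices of
the support of `u` have been found. Hence `A = α - 1 ≥ 15 (1 + δ)` iterations per support index
suffice, by induction on the number of missing indices (`residualEnergy_le_of_missing`).

The lower isometry bound at order `2αk` turns the small residual into an `ℓ₂` error, and Hölder on
the joint support gives `ℓ_q`. -/

/-! ### Norms and the restricted isometry constant. -/

theorem ellNorm_nonneg {m : ℕ} {p : ℝ} (hp : 0 < p) (x : Fin m → ℝ) : 0 ≤ ellNorm p x := by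
  rw [ellNorm_eq_sum hp]
  positivity

theorem ellNorm_add_le {m : ℕ} {p : ℝ} (hp : 1 ≤ p) (x y : Fin m → ℝ) :
    ellNorm p (x + y) ≤ ellNorm p x + ellNorm p y := by
  have : Fact (1 ≤ ENNReal.ofReal p) := ⟨by simpa using hp⟩
  unfold ellNorm
  rw [WithLp.toLp_add]
  exact norm_add_le _ _

theorem ellNorm_rpow {m : ℕ} {p : ℝ} (hp : 0 < p) (x : Fin m → ℝ) :
    ellNorm p x ^ p = ∑ i, |x i| ^ p := by
  rw [ellNorm_eq_sum hp, ← Real.rpow_mul (by positivity), one_div, inv_mul_cancel₀ hp.ne',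
    Real.rpow_one]

theorem ellNorm_two_sq {m : ℕ} (x : Fin m → ℝ) : ellNorm 2 x ^ 2 = x ⬝ᵥ x := by
  have h := ellNorm_rpow two_pos x
  rw [Real.rpow_two] at h
  rw [h]
  refine Finset.sum_congr rfl fun i _ => ?_
  rw [Real.rpow_two, sq_abs, sq]

theorem dotProduct_self_nonneg_real {m : ℕ} (x : Fin m → ℝ) : 0 ≤ x ⬝ᵥ x :=
  Finset.sum_nonneg fun i _ => mul_self_nonneg (x i)

theorem dotProduct_self_mulVec_le {n N : ℕ} (Φ : Matrix (Fin n) (Fin N) ℝ) (x : Fin N → ℝ) :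
    Φ.mulVec x ⬝ᵥ Φ.mulVec x ≤ (∑ i, ∑ j, Φ i j ^ 2) * (x ⬝ᵥ x) := by
  rw [Finset.sum_mul]
  refine Finset.sum_le_sum fun i _ => ?_
  have h := Finset.sum_mul_sq_le_sq_mul_sq Finset.univ (fun j => Φ i j) x
  simpa only [Matrix.mulVec, dotProduct, ← sq] using h

/-- The admissible constants form a nonempty closed set bounded below, so the infimum is itself
admissible. -/
theorem restrictedIsometry_ripConst {n N : ℕ} (Φ : Matrix (Fin n) (Fin N) ℝ) (s : ℝ) :
    0 ≤ ripConst Φ s ∧ RestrictedIsometry Φ s (ripConst Φ s) := by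
  refine IsClosed.csInf_mem (s := {d : ℝ | 0 ≤ d ∧ RestrictedIsometry Φ s d}) ?_ ?_ ⟨0, fun d hd => hd.1⟩
  · have : {d : ℝ | 0 ≤ d ∧ RestrictedIsometry Φ s d} = Set.Ici 0 ∩ ⋂ x ∈ sparseVectors N s,
        ({d | (1 - d) * ellNorm 2 x ^ 2 ≤ ellNorm 2 (Φ.mulVec x) ^ 2} ∩
          {d | ellNorm 2 (Φ.mulVec x) ^ 2 ≤ (1 + d) * ellNorm 2 x ^ 2}) := by
      ext d
      simp [RestrictedIsometry]
    rw [this]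
    refine isClosed_Ici.inter (isClosed_biInter fun x _ => IsClosed.inter ?_ ?_)
    · exact isClosed_le (by fun_prop) (by fun_prop)
    · exact isClosed_le (by fun_prop) (by fun_prop)
  · refine ⟨(∑ i, ∑ j, Φ i j ^ 2) + 1, by positivity, fun x _ => ?_⟩
    have h := dotProduct_self_mulVec_le Φ x
    have h1 := dotProduct_self_nonneg_real x
    have h2 := dotProduct_self_nonneg_real (Φ.mulVec x)
    have h3 : 0 ≤ ∑ i, ∑ j, Φ i j ^ 2 := by positivity
    have h4 := mul_nonneg h3 h1
    simp only [ellNorm_two_sq]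
    constructor <;> nlinarith

theorem mem_sparseVectors_of_support {N : ℕ} {s : ℝ} {x : Fin N → ℝ} (S : Finset (Fin N))
    (hx : ∀ i, i ∉ S → x i = 0) (hS : (S.card : ℝ) ≤ s) : x ∈ sparseVectors N s := by
  refine le_trans ?_ hS
  unfold hammingNorm
  exact_mod_cast Finset.card_le_card fun i hi => by
    by_contra h
    simp [hx i h] at hi

/-! ### The residual as a quadratic form, and one greedy step. -/

/-- The squared residual `‖y - Φ c‖²`. -/
def residualEnergy {n N : ℕ} (Φ : Matrix (Fin n) (Fin N) ℝ) (y : Fin n → ℝ) (c : Fin N → ℝ) : ℝ :=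
  (y - Φ.mulVec c) ⬝ᵥ (y - Φ.mulVec c)

/-- The correlations of the columns of `Φ` with the residual. -/
def correlation {n N : ℕ} (Φ : Matrix (Fin n) (Fin N) ℝ) (y : Fin n → ℝ) (c : Fin N → ℝ) :
    Fin N → ℝ :=
  Φ.transpose.mulVec (y - Φ.mulVec c)

section Greedy

variable {n N : ℕ} {Φ : Matrix (Fin n) (Fin N) ℝ} {y : Fin n → ℝ}

theorem residualEnergy_nonneg (c : Fin N → ℝ) : 0 ≤ residualEnergy Φ y c :=
  dotProduct_self_nonneg_real _

theorem residualEnergy_add (c d : Fin N → ℝ) :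
    residualEnergy Φ y (c + d) =
      residualEnergy Φ y c - 2 * (correlation Φ y c ⬝ᵥ d) + Φ.mulVec d ⬝ᵥ Φ.mulVec d := by
  have h : correlation Φ y c ⬝ᵥ d = (y - Φ.mulVec c) ⬝ᵥ Φ.mulVec d := by
    rw [correlation, Matrix.mulVec_transpose, ← Matrix.dotProduct_mulVec]
  unfold residualEnergy
  rw [h, Matrix.mulVec_add, ← sub_sub, sub_dotProduct, dotProduct_sub, dotProduct_sub _ _ (Φ.mulVec d),
    dotProduct_comm (Φ.mulVec d) (y - Φ.mulVec c)]
  ring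

/-- First-order optimality along a coordinate. -/
theorem correlation_eq_zero {c : Fin N → ℝ} {i : Fin N}
    (h : ∀ a : ℝ, residualEnergy Φ y c ≤ residualEnergy Φ y (c + Pi.single i a)) :
    correlation Φ y c i = 0 := by
  set g := correlation Φ y c i with hg
  set W := Φ.col i ⬝ᵥ Φ.col i with hW
  have hW0 : 0 ≤ W := dotProduct_self_nonneg_real _
  -- The optimal step is `g / W`; the `+ 1` covers a zero column and still gives a strict decrease
  -- unless `g = 0`.
  have key := h (g / (W + 1))
  rw [residualEnergy_add, dotProduct_single, Matrix.mulVec_single, ← hg] at key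
  simp only [op_smul_eq_smul, smul_dotProduct, dotProduct_smul, ← hW, smul_eq_mul] at key
  have h1 : 0 < W + 1 := by linarith
  have h2 : 2 * (g * (g / (W + 1))) = (2 * g ^ 2 * (W + 1)) / (W + 1) ^ 2 := by field_simp
  have h3 : g / (W + 1) * (g / (W + 1) * W) = (g ^ 2 * W) / (W + 1) ^ 2 := by field_simp
  have h4 : 0 ≤ (g ^ 2 * W - 2 * g ^ 2 * (W + 1)) / (W + 1) ^ 2 := by
    rw [sub_div]; linarith
  rw [le_div_iff₀ (by positivity)] at h4
  have h5 : g ^ 2 ≤ 0 := by nlinarith [mul_nonneg (sq_nonneg g) hW0]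
  exact pow_eq_zero_iff two_ne_zero |>.1 (le_antisymm h5 (sq_nonneg g))

/-- The correlation vanishes on `Λ` and `v - c` vanishes off `Λ ∪ D`, so their pairing involves at
most `t` terms, each controlled by the maximal correlation `|g j|`. A large excess therefore forces
a large `|g j|`, and moving along `j` alone already gains `g j ^ 2 / up`. -/
theorem residualEnergy_greedy_step {Λ D : Finset (Fin N)} {c v : Fin N → ℝ} {j : Fin N}
    {Q' lo up t : ℝ} (hlo : 0 < lo) (hup : 0 < up) (ht : 0 < t) (hD : (D.card : ℝ) ≤ t)
    (hΛ : ∀ i ∈ Λ, correlation Φ y c i = 0) (hc : ∀ i, i ∉ Λ → c i = 0)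
    (hj : ∀ i, |correlation Φ y c i| ≤ |correlation Φ y c j|)
    (hcol : ∀ a : ℝ, Φ.mulVec (Pi.single j a) ⬝ᵥ Φ.mulVec (Pi.single j a) ≤ up * a ^ 2)
    (hQ' : ∀ a : ℝ, Q' ≤ residualEnergy Φ y (c + Pi.single j a))
    (hv : ∀ i, i ∉ Λ → i ∉ D → v i = 0)
    (hlow : lo * ((v - c) ⬝ᵥ (v - c)) ≤ Φ.mulVec (v - c) ⬝ᵥ Φ.mulVec (v - c)) :
    Q' - residualEnergy Φ y v ≤
      (1 - lo / up / t) * (residualEnergy Φ y c - residualEnergy Φ y v) := by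
  set g := correlation Φ y c with hg
  set X := (v - c) ⬝ᵥ (v - c) with hX
  have hX0 : 0 ≤ X := dotProduct_self_nonneg_real _
  have hinner : g ⬝ᵥ (v - c) ≤ |g j| * √(t * X) := by
    have h1 : g ⬝ᵥ (v - c) = ∑ i ∈ D, g i * (if i ∈ Λ then 0 else (v - c) i) := by
      rw [dotProduct]
      symm
      rw [← Finset.sum_subset (Finset.subset_univ D)]
      · refine Finset.sum_congr rfl fun i _ => ?_
        split_ifs with h
        · simp [hΛ i h]
        · rfl
      · intro i _ hi
        by_cases h : i ∈ Λ
        · simp [hΛ i h]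
        · simp [hv i h hi, hc i h]
    rw [h1]
    have h2 : ∑ i ∈ D, g i * (if i ∈ Λ then 0 else (v - c) i) ≤ ∑ i ∈ D, |g j| * |(v - c) i| := by
      refine Finset.sum_le_sum fun i _ => ?_
      refine (le_abs_self _).trans ?_
      rw [abs_mul]
      refine mul_le_mul (hj i) ?_ (abs_nonneg _) (abs_nonneg _)
      split_ifs
      · simp
      · rfl
    refine h2.trans ?_
    rw [← Finset.mul_sum]
    refine mul_le_mul_of_nonneg_left (Real.le_sqrt_of_sq_le ?_) (abs_nonneg _)
    refine sq_sum_le_card_mul_sum_sq.trans ?_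
    refine mul_le_mul hD ?_ (by positivity) ht.le
    rw [hX, dotProduct]
    refine (Finset.sum_le_sum_of_subset_of_nonneg (Finset.subset_univ D)
      fun i _ _ => by positivity).trans (Finset.sum_le_sum fun i _ => ?_)
    rw [sq_abs, sq]
  have hexp : residualEnergy Φ y v = residualEnergy Φ y c - 2 * (g ⬝ᵥ (v - c)) +
      Φ.mulVec (v - c) ⬝ᵥ Φ.mulVec (v - c) := by
    rw [← residualEnergy_add]; congr 1; abel
  have hstep : Q' ≤ residualEnergy Φ y c - g j ^ 2 / up := by
    refine (hQ' (g j / up)).trans ?_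
    rw [residualEnergy_add, dotProduct_single, ← hg]
    have h1 := hcol (g j / up)
    have h2 : up * (g j / up) ^ 2 = g j ^ 2 / up := by field_simp
    have h3 : g j * (g j / up) = g j ^ 2 / up := by ring
    rw [h3]; linarith
  have hgap : lo * (residualEnergy Φ y c - residualEnergy Φ y v) ≤ g j ^ 2 * t := by
    have h1 : √(t * X) ^ 2 = t * X := Real.sq_sqrt (by positivity)
    have h2 : residualEnergy Φ y c - residualEnergy Φ y v ≤ 2 * (|g j| * √(t * X)) - lo * X := by
      linarith
    have h3 : t * (lo * (residualEnergy Φ y c - residualEnergy Φ y v)) ≤ t * (g j ^ 2 * t) := by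
      have h4 := mul_le_mul_of_nonneg_left h2 (mul_pos ht hlo).le
      have h5 : |g j| ^ 2 = g j ^ 2 := sq_abs _
      -- AM-GM removes the unknown distance `X` between `v` and `c`.
      have h6 := sq_nonneg (|g j| * t - lo * √(t * X))
      rw [sub_sq, mul_pow, mul_pow, h1, h5] at h6
      linarith
    exact le_of_mul_le_mul_left h3 ht
  have h7 : lo / up / t * (residualEnergy Φ y c - residualEnergy Φ y v) ≤ g j ^ 2 / up := by
    rw [div_div, div_mul_eq_mul_div, div_le_div_iff₀ (by positivity) hup]
    nlinarith
  linarith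

/-! ### Whole runs and geometric decrease. -/

/-- The index sets and iterates of a run of Orthogonal Matching Pursuit with `M` iterations. -/
structure OMPRun (Φ : Matrix (Fin n) (Fin N) ℝ) (y : Fin n → ℝ) (M : ℕ)
    (Λ : ℕ → Finset (Fin N)) (c : ℕ → Fin N → ℝ) : Prop where
  zero : Λ 0 = ∅
  step : ∀ l < M, ∃ j, Λ (l + 1) = insert j (Λ l) ∧
    ∀ i, |correlation Φ y (c l) i| ≤ |correlation Φ y (c l) j|
  supported : ∀ l ≤ M, ∀ i, i ∉ Λ l → c l i = 0
  minimal : ∀ l ≤ M, ∀ z : Fin N → ℝ, (∀ i, i ∉ Λ l → z i = 0) →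
    residualEnergy Φ y (c l) ≤ residualEnergy Φ y z

theorem residualEnergy_le_of_ellNorm_le {c z : Fin N → ℝ}
    (h : ellNorm 2 (y - Φ.mulVec c) ≤ ellNorm 2 (y - Φ.mulVec z)) :
    residualEnergy Φ y c ≤ residualEnergy Φ y z := by
  unfold residualEnergy
  rw [← ellNorm_two_sq, ← ellNorm_two_sq]
  exact pow_le_pow_left₀ (ellNorm_nonneg two_pos _) h 2

/-- A state remembers only its last index set and iterate; the analysis compares different times and
needs the whole history. -/
theorem OMPState.exists_run {M : ℕ} {Λ : Finset (Fin N)} {c : Fin N → ℝ}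
    (h : OMPState Φ y M Λ c) :
    ∃ Λs cs, OMPRun Φ y M Λs cs ∧ Λs M = Λ ∧ cs M = c := by
  induction h with
  | init =>
    refine ⟨fun _ => ∅, fun _ => 0, ⟨rfl, by simp, by simp, fun l _ z hz => ?_⟩, rfl, rfl⟩
    have : z = 0 := funext fun i => hz i (by simp)
    rw [this]
  | @step l Λ c j c' prev identify supported update ih =>
    obtain ⟨Λs, cs, hrun, rfl, rfl⟩ := ih
    refine ⟨Function.update Λs (l + 1) (insert j (Λs l)), Function.update cs (l + 1) c',
      ⟨?_, ?_, ?_, ?_⟩, by simp, by simp⟩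
    · rw [Function.update_of_ne (by omega), hrun.zero]
    · intro i hi
      rcases Nat.lt_succ_iff_lt_or_eq.1 hi with hi | rfl
      · rw [Function.update_of_ne (by omega), Function.update_of_ne (by omega),
          Function.update_of_ne (by omega)]
        exact hrun.step i hi
      · refine ⟨j, ?_, ?_⟩
        · rw [Function.update_self, Function.update_of_ne (by omega)]
        · rw [Function.update_of_ne (by omega)]
          exact identify
    · intro i hi
      rcases Nat.le_succ_iff.1 hi with hi | rfl
      · rw [Function.update_of_ne (by omega), Function.update_of_ne (by omega)]
        exact hrun.supported i hi
      · rw [Function.update_self, Function.update_self]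
        exact supported
    · intro i hi
      rcases Nat.le_succ_iff.1 hi with hi | rfl
      · rw [Function.update_of_ne (by omega), Function.update_of_ne (by omega)]
        exact hrun.minimal i hi
      · rw [Function.update_self, Function.update_self]
        exact fun z hz => residualEnergy_le_of_ellNorm_le (update z hz)

namespace OMPRun

variable {M : ℕ} {Λ : ℕ → Finset (Fin N)} {c : ℕ → Fin N → ℝ}

theorem card_le (h : OMPRun Φ y M Λ c) {l : ℕ} (hl : l ≤ M) : (Λ l).card ≤ l := by
  induction l with
  | zero => simp [h.zero]
  | succ l ih =>
    obtain ⟨j, hj, -⟩ := h.step l hl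
    rw [hj]
    exact (Finset.card_insert_le _ _).trans (Nat.succ_le_succ (ih (by omega)))

theorem subset (h : OMPRun Φ y M Λ c) {l l' : ℕ} (hll : l ≤ l') (hl : l' ≤ M) : Λ l ⊆ Λ l' := by
  induction l', hll using Nat.le_induction with
  | base => exact subset_rfl
  | succ m hm ih =>
    obtain ⟨j, hj, -⟩ := h.step m hl
    rw [hj]
    exact (ih (by omega)).trans (Finset.subset_insert _ _)

theorem residualEnergy_anti (h : OMPRun Φ y M Λ c) {l l' : ℕ} (hll : l ≤ l') (hl : l' ≤ M) :
    residualEnergy Φ y (c l') ≤ residualEnergy Φ y (c l) :=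
  h.minimal l' hl _ fun i hi =>
    h.supported l (hll.trans hl) i fun hi' => hi (h.subset hll hl hi')

theorem correlation_eq_zero (h : OMPRun Φ y M Λ c) {l : ℕ} (hl : l ≤ M) {i : Fin N}
    (hi : i ∈ Λ l) : correlation Φ y (c l) i = 0 := by
  refine _root_.correlation_eq_zero fun a => h.minimal l hl _ fun i' hi' => ?_
  have : i' ≠ i := fun e => hi' (e ▸ hi)
  simp [this, h.supported l hl i' hi']

/-- Geometric decrease of the excess residual over a target whose support exceeds the current
index set by at most `t` indices. -/
theorem residualEnergy_contract (h : OMPRun Φ y M Λ c) {D : Finset (Fin N)} {v : Fin N → ℝ}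
    {lo up t : ℝ} {l r : ℕ} (hlr : l + r ≤ M)
    (hlo : 0 < lo) (hlu : lo ≤ up) (ht : 1 ≤ t) (hD : (D.card : ℝ) ≤ t)
    (hcol : ∀ (j : Fin N) (a : ℝ),
      Φ.mulVec (Pi.single j a) ⬝ᵥ Φ.mulVec (Pi.single j a) ≤ up * a ^ 2)
    (hv : ∀ i, i ∉ Λ l → i ∉ D → v i = 0)
    (hlow : ∀ l' ≤ M,
      lo * ((v - c l') ⬝ᵥ (v - c l')) ≤ Φ.mulVec (v - c l') ⬝ᵥ Φ.mulVec (v - c l')) :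
    residualEnergy Φ y (c (l + r)) - residualEnergy Φ y v ≤
      (1 - lo / up / t) ^ r * (residualEnergy Φ y (c l) - residualEnergy Φ y v) := by
  have hup : 0 < up := hlo.trans_le hlu
  have hfac : 0 ≤ 1 - lo / up / t := by
    rw [sub_nonneg, div_le_one (by linarith)]
    exact ((div_le_one hup).2 hlu).trans ht
  induction r with
  | zero => simp
  | succ r ih =>
    obtain ⟨j, hj, hmax⟩ := h.step (l + r) (by omega)
    have h1 := residualEnergy_greedy_step (Q' := residualEnergy Φ y (c (l + r + 1)))
      (Λ := Λ (l + r)) hlo hup (by linarith) hD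
      (fun i hi => h.correlation_eq_zero (by omega) hi)
      (h.supported (l + r) (by omega)) hmax (hcol j)
      (fun a => h.minimal (l + r + 1) hlr _ fun i hi => ?_)
      (fun i hi hi' => hv i (fun hi'' => hi (h.subset (by omega) (by omega) hi'')) hi')
      (hlow (l + r) (by omega))
    · refine h1.trans ?_
      rw [pow_succ', mul_assoc]
      exact mul_le_mul_of_nonneg_left (ih (by omega)) hfac
    · rw [hj, Finset.mem_insert, not_or] at hi
      simp [hi.1, h.supported (l + r) (by omega) i hi.2]

end OMPRun

end Greedy

/-! ### The multiscale argument for sparse recovery. -/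

theorem dotProduct_self_add_le {m : ℕ} (a b : Fin m → ℝ) {θ : ℝ} (hθ : 0 < θ) :
    (a + b) ⬝ᵥ (a + b) ≤ (1 + θ) * (a ⬝ᵥ a) + (1 + 1 / θ) * (b ⬝ᵥ b) := by
  simp only [dotProduct, Finset.mul_sum, ← Finset.sum_add_distrib]
  refine Finset.sum_le_sum fun i _ => ?_
  have h : 0 ≤ (θ * a i - b i) ^ 2 / θ := by positivity
  have h2 : (θ * a i - b i) ^ 2 / θ =
      (1 + θ) * (a i * a i) + (1 + 1 / θ) * (b i * b i) - (a i + b i) * (a i + b i) := by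
    field_simp
    ring
  rw [h2] at h
  simpa using h

/-- `X` plays the part of the `t` heaviest indices. Read contrapositively, a subset whose sum is
below the optimal tail omits more than `t` indices of `D`. -/
theorem exists_subset_minimizing_tail {ι : Type*} [DecidableEq ι] (D : Finset ι) (f : ι → ℝ)
    (t : ℕ) :
    ∃ X ⊆ D, X.card ≤ t ∧ ∀ D' ⊆ D, D.card ≤ D'.card + t → ∑ i ∈ D \ X, f i ≤ ∑ i ∈ D', f i := by
  obtain ⟨X, hX, hmin⟩ := Finset.exists_min_image (D.powerset.filter fun X => X.card ≤ t)
    (fun X => ∑ i ∈ D \ X, f i) ⟨∅, by simp⟩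
  simp only [Finset.mem_filter, Finset.mem_powerset] at hX hmin
  refine ⟨X, hX.1, hX.2, fun D' hD' hcard => ?_⟩
  have h := hmin (D \ D') ⟨Finset.sdiff_subset, by
    rw [Finset.card_sdiff_of_subset hD']; omega⟩
  rwa [Finset.sdiff_sdiff_eq_self hD'] at h

theorem one_sub_pow_le_one_div_forty {a : ℝ} {r : ℕ} (ha : a ≤ 1) (h : 15 / 4 ≤ a * r) :
    (1 - a) ^ r ≤ 1 / 40 := by
  have h1 : (1 - a) ^ r ≤ Real.exp (-(15 / 4)) := by
    calc (1 - a) ^ r ≤ Real.exp (-a) ^ r :=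
          pow_le_pow_left₀ (by linarith) (Real.one_sub_le_exp_neg a) r
      _ = Real.exp (r * -a) := (Real.exp_nat_mul _ _).symm
      _ ≤ Real.exp (-(15 / 4)) := Real.exp_le_exp.2 (by linarith)
  have h2 : (40 : ℝ) ≤ Real.exp (15 / 4) := by
    have h3 : Real.exp (15 / 4) ^ 4 = Real.exp 1 ^ 15 := by
      rw [← Real.exp_nat_mul, ← Real.exp_nat_mul]; norm_num
    have h4 : (2.7 : ℝ) ^ 15 ≤ Real.exp 1 ^ 15 :=
      pow_le_pow_left₀ (by norm_num) (by linarith [Real.exp_one_gt_d9]) 15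
    refine le_of_pow_le_pow_left₀ (n := 4) (by norm_num) (Real.exp_pos _).le ?_
    rw [h3]
    refine le_trans ?_ h4
    norm_num
  refine h1.trans ?_
  rw [Real.exp_neg, ← one_div]
  exact one_div_le_one_div_of_le (by norm_num) h2

/-- The number of iterations after which the `j`-th dyadic target is reached, when `A` iterations
are allowed for each missing index. -/
def dyadicIterations (A : ℕ) : ℕ → ℕ
  | 0 => 0
  | j + 1 => A * 2 ^ j

/-- A phase whose target lacks `t = 2 ^ (j + 1) - 1` indices lasts at least `A t / 4` steps; with
`15 κ ≤ A` this is the exponent `15 / 4` of `one_sub_pow_le_one_div_forty`. -/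
theorem exists_dyadicIterations_succ (A j : ℕ) :
    ∃ r, dyadicIterations A (j + 1) = dyadicIterations A j + r ∧ A * (2 ^ (j + 1) - 1) ≤ 4 * r := by
  cases j with
  | zero => exact ⟨A, by simp [dyadicIterations], by simp; omega⟩
  | succ j =>
    refine ⟨A * 2 ^ j, by simp only [dyadicIterations]; ring, ?_⟩
    calc A * (2 ^ (j + 1 + 1) - 1) ≤ A * 2 ^ (j + 1 + 1) := Nat.mul_le_mul_left _ (Nat.sub_le _ _)
      _ = 4 * (A * 2 ^ j) := by ring

theorem dyadicIterations_mono (A : ℕ) : Monotone (dyadicIterations A) :=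
  monotone_nat_of_le_succ fun j => by
    obtain ⟨r, hr, -⟩ := exists_dyadicIterations_succ A j
    omega

section Greedy

variable {n N : ℕ} {Φ : Matrix (Fin n) (Fin N) ℝ}

/-- If `A` iterations remain for every index of the support of `u` not selected yet, then the final
residual of a run on `Φ u + e` is at most a multiple of the noise. -/
theorem OMPRun.residualEnergy_le_of_missing {M : ℕ} {Λ : ℕ → Finset (Fin N)} {c : ℕ → Fin N → ℝ}
    {u : Fin N → ℝ} {e : Fin n → ℝ} (h : OMPRun Φ (Φ.mulVec u + e) M Λ c)
    {S : Finset (Fin N)} (hu : ∀ i, i ∉ S → u i = 0) {lo up κ : ℝ} {A : ℕ}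
    (hlo : 0 < lo) (hlu : lo ≤ up) (hκ : up ≤ κ * lo) (hκ2 : κ ≤ 2) (hA : 15 * κ ≤ A)
    (hcol : ∀ (j : Fin N) (a : ℝ),
      Φ.mulVec (Pi.single j a) ⬝ᵥ Φ.mulVec (Pi.single j a) ≤ up * a ^ 2)
    (hupper : ∀ v : Fin N → ℝ, (∀ i, i ∉ S → v i = 0) →
      Φ.mulVec v ⬝ᵥ Φ.mulVec v ≤ up * (v ⬝ᵥ v))
    (hlower : ∀ v : Fin N → ℝ, (∀ i, i ∉ S → i ∉ Λ M → v i = 0) →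
      lo * (v ⬝ᵥ v) ≤ Φ.mulVec v ⬝ᵥ Φ.mulVec v)
    (s l : ℕ) (hs : (S \ Λ l).card = s) (hl : l + A * s ≤ M) :
    residualEnergy Φ (Φ.mulVec u + e) (c M) ≤ 11 * (e ⬝ᵥ e) := by
  induction s using Nat.strong_induction_on generalizing l with
  | _ s ih =>
  set y := Φ.mulVec u + e with hy
  set D := S \ Λ l with hD
  have hee : 0 ≤ e ⬝ᵥ e := dotProduct_self_nonneg_real e
  have hup : 0 < up := hlo.trans_le hlu
  have hlM : l ≤ M := by omega
  choose X hXD hXcard hXmin using fun j : ℕ =>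
    exists_subset_minimizing_tail D (fun i => u i ^ 2) (2 ^ j - 1)
  set E : ℕ → ℝ := fun j => ∑ i ∈ D \ X j, u i ^ 2 with hE
  set tail : ℕ → Fin N → ℝ := fun j i => if i ∈ D \ X j then u i else 0 with htail
  set v : ℕ → Fin N → ℝ := fun j => u - tail j with hv
  have hE0 : ∀ j, 0 ≤ E j := fun j => Finset.sum_nonneg fun i _ => sq_nonneg _
  have htailE : ∀ j, tail j ⬝ᵥ tail j = E j := by
    intro j
    rw [dotProduct, ← Finset.sum_subset (Finset.subset_univ (D \ X j))
      (fun i _ hi => by simp only [htail, if_neg hi, mul_zero])]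
    exact Finset.sum_congr rfl fun i hi => by simp only [htail, if_pos hi, sq]
  have hvQ : ∀ j, residualEnergy Φ y (v j) ≤ 2 * up * E j + 2 * (e ⬝ᵥ e) := by
    intro j
    have h1 : y - Φ.mulVec (v j) = Φ.mulVec (tail j) + e := by
      simp only [hv, hy, Matrix.mulVec_sub]; abel
    rw [residualEnergy, h1]
    have h2 := dotProduct_self_add_le (Φ.mulVec (tail j)) e one_pos
    have h3 := hupper (tail j) fun i hi => by
      simp [htail, hD, hi]
    rw [htailE] at h3
    linarith
  have hvsupp : ∀ j i, i ∉ Λ l → i ∉ X j → v j i = 0 := by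
    intro j i hi hi'
    by_cases hiS : i ∈ S
    · simp [hv, htail, hD, hi, hi', hiS]
    · simp [hv, htail, hD, hiS, hu i hiS]
  have hvS : ∀ j i, i ∉ S → v j i = 0 := by
    intro j i hi
    simp [hv, htail, hD, hi, hu i hi]
  have hX0 : X 0 = ∅ := by
    have := hXcard 0
    simpa using this
  have hQ0 : residualEnergy Φ y (c l) ≤ residualEnergy Φ y (v 0) :=
    h.minimal l hlM _ fun i hi => hvsupp 0 i hi (by simp [hX0])
  have hElarge : ∀ j, s ≤ 2 ^ j - 1 → E j = 0 := fun j hj =>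
    le_antisymm (by simpa using hXmin j ∅ (by simp) (by simpa [hs] using hj)) (hE0 j)
  rcases (hE0 0).eq_or_lt with hzero | hpos
  · have h1 := hvQ 0
    rw [← hzero] at h1
    have h2 := h.residualEnergy_anti hlM le_rfl
    linarith
  -- Maximality of `20 ^ j * E j` at `b` says `E j ≤ 20 ^ (b - j) * E b` for `j ≤ b`, and that `E (b
  -- + 1)` is at most `E b / 20`.
  obtain ⟨b, -, hb⟩ := Finset.exists_max_image (Finset.range (s + 1)) (fun j => 20 ^ j * E j)
    ⟨0, by simp⟩
  have hmax : ∀ j, 20 ^ j * E j ≤ 20 ^ b * E b := by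
    intro j
    by_cases hj : j < s + 1
    · exact hb j (Finset.mem_range.2 hj)
    · rw [hElarge j (by have := Nat.lt_two_pow_self (n := j); omega), mul_zero]
      exact mul_nonneg (by positivity) (hE0 b)
  have hEb : 0 < E b := by
    have h1 := hmax 0
    rw [pow_zero, one_mul] at h1
    exact pos_of_mul_pos_right (hpos.trans_le h1) (by positivity)
  have hbs : 2 ^ b ≤ s := by
    by_contra hlt
    exact hEb.ne' (hElarge b (by omega))
  have hlast : l + A * 2 ^ b ≤ M := le_trans (by gcongr) hl
  -- A phase contracts by `1 / 40` while the weight grows by `20`, so the weighted residual is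
  -- halved and gains `2 * up * (20 ^ b * E b)`: the bound with `4` is preserved. For the noise, `2
  -- + 2.1 / 40 ≤ 2.1`.
  have hphase : ∀ j ≤ b + 1, 20 ^ j * residualEnergy Φ y (c (l + dyadicIterations A j)) ≤
      4 * up * (20 ^ b * E b) + 20 ^ j * (21 / 10 * (e ⬝ᵥ e)) := by
    intro j
    induction j with
    | zero =>
      intro _
      have h1 := hvQ 0
      have h2 := mul_le_mul_of_nonneg_left (hmax 0) hup.le
      have h3 : 0 ≤ up * (20 ^ b * E b) := by positivity
      simp only [dyadicIterations, add_zero, pow_zero, one_mul] at h2 ⊢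
      linarith
    | succ j ihj =>
      intro hj
      have hprev := ihj (by omega)
      obtain ⟨r, hr, hAr⟩ := exists_dyadicIterations_succ A j
      have hend : l + dyadicIterations A j + r ≤ M := by
        have h1 : dyadicIterations A (j + 1) ≤ A * 2 ^ b := dyadicIterations_mono A hj
        omega
      have hone : 1 ≤ 2 ^ (j + 1) - 1 := by
        have := Nat.lt_two_pow_self (n := j + 1)
        omega
      have ht1 : (1 : ℝ) ≤ ((2 ^ (j + 1) - 1 : ℕ) : ℝ) := by exact_mod_cast hone
      have hAr' : (A : ℝ) * ((2 ^ (j + 1) - 1 : ℕ) : ℝ) ≤ 4 * r := by exact_mod_cast hAr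
      set t : ℝ := ((2 ^ (j + 1) - 1 : ℕ) : ℝ) with ht
      have hcontr := h.residualEnergy_contract (D := X (j + 1)) (v := v (j + 1)) (t := t)
        hend hlo hlu ht1 (Nat.cast_le.2 (hXcard (j + 1))) hcol
        (fun i hi hi' => hvsupp (j + 1) i
          (fun hi'' => hi (h.subset (by omega) (by omega) hi'')) hi')
        (fun l' hl' => hlower _ fun i hi hi' => by
          simp only [Pi.sub_apply]
          rw [hvS _ i hi, h.supported l' hl' i fun hi'' => hi' (h.subset hl' le_rfl hi''),
            sub_zero])
      have ha1 : lo / up / t ≤ 1 := by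
        rw [div_le_one (by linarith)]
        exact ((div_le_one hup).2 hlu).trans ht1
      have hfac := one_sub_pow_le_one_div_forty (r := r) ha1 (by
        rw [div_div, div_mul_eq_mul_div, div_le_div_iff₀ (by norm_num) (by positivity)]
        have h1 : 15 * κ * t ≤ A * t := by gcongr
        have h2 : 15 * κ * t * lo ≤ 4 * r * lo :=
          mul_le_mul_of_nonneg_right (h1.trans hAr') hlo.le
        have h3 : up * t ≤ κ * lo * t := by gcongr
        linarith)
      have hfac0 : 0 ≤ (1 - lo / up / t) ^ r := pow_nonneg (by linarith) r
      rw [hr, ← add_assoc]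
      set Q := residualEnergy Φ y (c (l + dyadicIterations A j))
      have hQ : 0 ≤ Q := residualEnergy_nonneg _
      have hv0 : 0 ≤ residualEnergy Φ y (v (j + 1)) := residualEnergy_nonneg _
      have h1 : residualEnergy Φ y (c (l + dyadicIterations A j + r)) ≤
          2 * up * E (j + 1) + 2 * (e ⬝ᵥ e) + 1 / 40 * Q := by
        have h2 := mul_le_mul_of_nonneg_right hfac hQ
        have h3 := mul_nonneg hfac0 hv0
        have h4 := hvQ (j + 1)
        rw [mul_sub] at hcontr
        linarith
      have h2 := mul_le_mul_of_nonneg_left h1 (show (0 : ℝ) ≤ 20 ^ (j + 1) by positivity)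
      have h3 := mul_le_mul_of_nonneg_left (hmax (j + 1)) hup.le
      have h4 : (0 : ℝ) ≤ 20 ^ j * (e ⬝ᵥ e) := by positivity
      rw [pow_succ] at h2 h3 ⊢
      linarith
  have hfinal := hphase (b + 1) le_rfl
  simp only [dyadicIterations] at hfinal
  set l' := l + A * 2 ^ b with hl'
  set Q := residualEnergy Φ y (c l') with hQ
  have hQle : Q ≤ up * E b / 5 + 21 / 10 * (e ⬝ᵥ e) := by
    have h1 : (0 : ℝ) < 20 ^ (b + 1) := by positivity
    refine le_of_mul_le_mul_left (hfinal.trans (le_of_eq ?_)) h1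
    rw [pow_succ]
    ring
  by_cases hsmall : Q ≤ 11 * (e ⬝ᵥ e)
  · exact (h.residualEnergy_anti hlast le_rfl).trans hsmall
  push Not at hsmall
  have hDsub : S \ Λ l' ⊆ D :=
    Finset.sdiff_subset_sdiff subset_rfl (h.subset (Nat.le_add_right _ _) hlast)
  -- If fewer than `2 ^ b` indices had been found, the missing energy would be at least `E b`, so
  -- `lo * E b ≤ 4/3 * Q + 4 * (e ⬝ᵥ e)`. With `hQle` and `up ≤ 2 * lo` this contradicts `hsmall`.
  have hcount : (S \ Λ l').card + 2 ^ b ≤ s := by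
    by_contra hlt
    have h1 : E b ≤ ∑ i ∈ S \ Λ l', u i ^ 2 := hXmin b _ hDsub (by omega)
    have h2 : ∑ i ∈ S \ Λ l', u i ^ 2 ≤ (u - c l') ⬝ᵥ (u - c l') := by
      refine le_trans (le_of_eq ?_) (Finset.sum_le_sum_of_subset_of_nonneg
        (Finset.subset_univ (S \ Λ l')) fun i _ _ => mul_self_nonneg _)
      refine Finset.sum_congr rfl fun i hi => ?_
      rw [Pi.sub_apply, h.supported l' hlast i (Finset.mem_sdiff.1 hi).2, sub_zero, sq]
    have h3 := hlower (u - c l') fun i hi hi' => by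
      rw [Pi.sub_apply, hu i hi,
        h.supported l' hlast i fun hi'' => hi' (h.subset hlast le_rfl hi''), sub_zero]
    have h4 : Φ.mulVec (u - c l') = (y - Φ.mulVec (c l')) + -e := by
      rw [hy, Matrix.mulVec_sub]; abel
    have h5 := dotProduct_self_add_le (y - Φ.mulVec (c l')) (-e) (show (0 : ℝ) < 1 / 3 by norm_num)
    rw [← h4, neg_dotProduct_neg] at h5
    change _ ≤ _ * Q + _ at h5
    have h6 := mul_le_mul_of_nonneg_left (h1.trans h2) hlo.le
    have h7 : up * E b ≤ 2 * (lo * E b) := by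
      have h8 : up ≤ 2 * lo := hκ.trans (mul_le_mul_of_nonneg_right hκ2 hlo.le)
      have := mul_le_mul_of_nonneg_right h8 hEb.le
      linarith
    norm_num at h5
    linarith
  have h2b : 0 < 2 ^ b := by positivity
  refine ih _ (by omega) l' rfl ?_
  calc l' + A * (S \ Λ l').card = l + A * ((S \ Λ l').card + 2 ^ b) := by rw [hl']; ring
    _ ≤ l + A * s := by gcongr
    _ ≤ M := hl

end Greedy

/-! ### Comparison of norms. -/

theorem ellNorm_le_of_abs_le {m : ℕ} {p : ℝ} (hp : 0 < p) {x y : Fin m → ℝ}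
    (h : ∀ i, |x i| ≤ |y i|) : ellNorm p x ≤ ellNorm p y := by
  rw [ellNorm_eq_sum hp, ellNorm_eq_sum hp]
  refine Real.rpow_le_rpow (by positivity) (Finset.sum_le_sum fun i _ => ?_) (by positivity)
  exact Real.rpow_le_rpow (abs_nonneg _) (h i) hp.le

theorem ellNorm_two_le_of_dotProduct_le {m : ℕ} {x : Fin m → ℝ} {b : ℝ} (hb : 0 ≤ b)
    (h : x ⬝ᵥ x ≤ b ^ 2) : ellNorm 2 x ≤ b := by
  rw [← ellNorm_two_sq] at h
  exact le_of_sq_le_sq h hb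

theorem ellNorm_one_eq_sum {m : ℕ} (x : Fin m → ℝ) : ellNorm 1 x = ∑ i, |x i| := by
  simp [ellNorm_eq_sum one_pos]

/-- Comparison of `ℓ_q` and `ℓ_r` norms, `q ≤ r`, for vectors with small support. -/
theorem ellNorm_le_card_rpow_mul {m : ℕ} {q r c : ℝ} (hq : 0 < q) (hqr : q ≤ r) {x : Fin m → ℝ}
    {T : Finset (Fin m)} (hx : ∀ i, i ∉ T → x i = 0) (hT : (T.card : ℝ) ≤ c) :
    ellNorm q x ≤ c ^ (1 / q - 1 / r) * ellNorm r x := by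
  have hr : 0 < r := hq.trans_le hqr
  have hc : 0 ≤ c := le_trans (by positivity) hT
  have hsum : ∀ s : ℝ, 0 < s → ∑ i, |x i| ^ s = ∑ i ∈ T, |x i| ^ s := fun s hs =>
    (Finset.sum_subset (Finset.subset_univ T) fun i _ hi => by
      rw [hx i hi, abs_zero, Real.zero_rpow hs.ne']).symm
  have h1 := Real.rpow_sum_le_const_mul_sum_rpow (s := T) (f := fun i => |x i| ^ q) (p := r / q)
    ((one_le_div hq).2 hqr)
  simp only [abs_of_nonneg (Real.rpow_nonneg (abs_nonneg _) q), ← Real.rpow_mul (abs_nonneg _),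
    mul_div_cancel₀ r hq.ne'] at h1
  have hexp : (0 : ℝ) ≤ r / q - 1 := sub_nonneg.2 ((one_le_div hq).2 hqr)
  have h2 : (∑ i ∈ T, |x i| ^ q) ^ (r / q) ≤ c ^ (r / q - 1) * ∑ i ∈ T, |x i| ^ r :=
    h1.trans (by gcongr)
  have h3 := Real.rpow_le_rpow (by positivity) h2 (show 0 ≤ 1 / r by positivity)
  rw [← Real.rpow_mul (by positivity), Real.mul_rpow (by positivity) (by positivity),
    ← Real.rpow_mul hc] at h3
  rw [ellNorm_eq_sum hq, ellNorm_eq_sum hr, hsum q hq, hsum r hr]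
  have e1 : r / q * (1 / r) = 1 / q := by field_simp
  have e2 : (r / q - 1) * (1 / r) = 1 / q - 1 / r := by field_simp
  rwa [e1, e2] at h3

/-- Interpolation between the sup norm and the `ℓ_p` norm. -/
theorem ellNorm_le_of_sup_le {m : ℕ} {p q b σ k : ℝ} (hp : 0 < p) (hpq : p ≤ q) (hk : 0 < k)
    {w : Fin m → ℝ} (hb : 0 ≤ b) (hσ : 0 ≤ σ) (hw : ∀ i, |w i| ≤ b) (hwσ : ellNorm p w ≤ σ)
    (hbσ : k * b ^ p ≤ σ ^ p) : ellNorm q w ≤ k ^ (1 / q - 1 / p) * σ := by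
  have hq : 0 < q := hp.trans_le hpq
  have hb' : b ≤ k ^ (-(1 / p)) * σ := by
    have h1 : b ^ p ≤ (k ^ (-(1 / p)) * σ) ^ p := by
      rw [Real.mul_rpow (by positivity) hσ, ← Real.rpow_mul hk.le, neg_mul, one_div,
        inv_mul_cancel₀ hp.ne', Real.rpow_neg_one, inv_mul_eq_div, le_div_iff₀ hk]
      linarith
    exact (Real.rpow_le_rpow_iff hb (by positivity) hp).1 h1
  have h1 : ∑ i, |w i| ^ q ≤ (k ^ (1 / q - 1 / p) * σ) ^ q := by
    calc ∑ i, |w i| ^ q = ∑ i, |w i| ^ (q - p) * |w i| ^ p := by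
          refine Finset.sum_congr rfl fun i _ => ?_
          rw [← Real.rpow_add_of_nonneg (abs_nonneg _) (by linarith) hp.le, sub_add_cancel]
      _ ≤ ∑ i, (k ^ (-(1 / p)) * σ) ^ (q - p) * |w i| ^ p := by
          gcongr with i
          · exact (hw i).trans hb'
      _ = (k ^ (-(1 / p)) * σ) ^ (q - p) * ellNorm p w ^ p := by
          rw [← Finset.mul_sum, ellNorm_rpow hp]
      _ ≤ (k ^ (-(1 / p)) * σ) ^ (q - p) * σ ^ p := by
          have := ellNorm_nonneg hp w
          gcongr
      _ = (k ^ (1 / q - 1 / p) * σ) ^ q := by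
          rw [Real.mul_rpow (by positivity) hσ, Real.mul_rpow (by positivity) hσ, mul_assoc,
            ← Real.rpow_add_of_nonneg hσ (by linarith) hp.le, sub_add_cancel,
            ← Real.rpow_mul hk.le, ← Real.rpow_mul hk.le]
          congr 2
          field_simp
          ring
  rw [ellNorm_eq_sum hq]
  refine (Real.rpow_le_rpow (by positivity) h1 (by positivity)).trans (le_of_eq ?_)
  rw [← Real.rpow_mul (by positivity), mul_one_div_cancel hq.ne', Real.rpow_one]

/-- A set of `m` indices carrying the largest values of `f` on `V`, with a separating threshold. -/
theorem exists_largest_subset {ι : Type*} [DecidableEq ι] (V : Finset ι) (f : ι → ℝ) {m : ℕ}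
    (hm : 0 < m) (hmV : m ≤ V.card) :
    ∃ B ⊆ V, B.card = m ∧ ∃ i ∈ B, (∀ j ∈ B, f i ≤ f j) ∧ ∀ j ∈ V, j ∉ B → f j ≤ f i := by
  induction m, hm using Nat.le_induction with
  | base =>
    obtain ⟨i, hi, hmax⟩ := V.exists_max_image f (Finset.card_pos.1 hmV)
    exact ⟨{i}, by simpa using hi, by simp, i, by simp, by simp, fun j hj _ => hmax j hj⟩
  | succ m hm ih =>
    obtain ⟨B, hBV, hB, i, hi, hmin, hrest⟩ := ih (by omega)
    obtain ⟨i', hi', hmax⟩ := (V \ B).exists_max_image f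
      (Finset.card_pos.1 (by rw [Finset.card_sdiff_of_subset hBV]; omega))
    rw [Finset.mem_sdiff] at hi'
    refine ⟨insert i' B, Finset.insert_subset hi'.1 hBV, by
      rw [Finset.card_insert_of_notMem hi'.2, hB], i', Finset.mem_insert_self _ _, ?_, ?_⟩
    · intro j hj
      rcases Finset.mem_insert.1 hj with rfl | hj
      · exact le_rfl
      · exact (hrest i' hi'.1 hi'.2).trans (hmin j hj)
    · intro j hj hj'
      rw [Finset.mem_insert, not_or] at hj'
      exact hmax j (Finset.mem_sdiff.2 ⟨hj, hj'.2⟩)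

/-! ### Measurements of vectors that are not sparse. -/

section Tail

variable {n N : ℕ} {Φ : Matrix (Fin n) (Fin N) ℝ}

theorem RestrictedIsometry.ellNorm_mulVec_le {s d : ℝ} (h : RestrictedIsometry Φ s d)
    (hd : 0 ≤ d) {V : Finset (Fin N)} (hV : (V.card : ℝ) ≤ s) {w : Fin N → ℝ}
    (hw : ∀ i, i ∉ V → w i = 0) : ellNorm 2 (Φ.mulVec w) ≤ √(1 + d) * ellNorm 2 w := by
  have h1 := (h w (mem_sparseVectors_of_support V hw hV)).2
  have h2 := ellNorm_nonneg two_pos w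
  refine le_of_sq_le_sq ?_ (by positivity)
  rwa [mul_pow, Real.sq_sqrt (by positivity)]

theorem ellNorm_two_le_of_support {m : ℕ} {w : Fin N → ℝ} {V : Finset (Fin N)} {b : ℝ}
    (hb : 0 ≤ b) (hw : ∀ i, i ∉ V → w i = 0) (hV : V.card ≤ m) (hwb : ∀ i, |w i| ≤ b) :
    ellNorm 2 w ≤ √m * b := by
  refine ellNorm_two_le_of_dotProduct_le (by positivity) ?_
  rw [mul_pow, Real.sq_sqrt (by positivity), dotProduct,
    ← Finset.sum_subset (Finset.subset_univ V) fun i _ hi => by rw [hw i hi, mul_zero]]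
  have h1 : ∑ i ∈ V, w i * w i ≤ V.card • b ^ 2 := Finset.sum_le_card_nsmul _ _ _ fun i _ => by
    rw [← sq, ← sq_abs]
    exact pow_le_pow_left₀ (abs_nonneg _) (hwb i) 2
  rw [nsmul_eq_mul] at h1
  refine h1.trans ?_
  gcongr

theorem abs_sum_piecewise_add {m : ℕ} (B : Finset (Fin m)) (w : Fin m → ℝ) :
    ∑ i, |B.piecewise w 0 i| = ∑ i ∈ B, |w i| ∧
      ∑ i, |w i| = ∑ i ∈ B, |w i| + ∑ i, |(w - B.piecewise w 0) i| := by
  have h1 : ∑ i, |B.piecewise w 0 i| = ∑ i ∈ B, |w i| := by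
    rw [← Finset.sum_subset (Finset.subset_univ B) fun i _ hi => by simp [hi]]
    exact Finset.sum_congr rfl fun i hi => by simp [hi]
  refine ⟨h1, ?_⟩
  rw [← h1, ← Finset.sum_add_distrib]
  refine Finset.sum_congr rfl fun i _ => ?_
  by_cases hi : i ∈ B <;> simp [hi]

/-- Splitting off the block of the `m` largest entries of `w`. -/
theorem exists_block_split {m : ℕ} (hm : 0 < m) {V : Finset (Fin N)} {w : Fin N → ℝ}
    (hw : ∀ i, i ∉ V → w i = 0) (hmV : m ≤ V.card) :
    ∃ B ⊆ V, B.card = m ∧ ∃ b, 0 ≤ b ∧ (∀ i, |(w - B.piecewise w 0) i| ≤ b) ∧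
      √m * b ≤ (∑ i ∈ B, |w i|) / √m := by
  obtain ⟨B, hBV, hB, i, hi, hmin, hrest⟩ := exists_largest_subset V (fun i => |w i|) hm hmV
  refine ⟨B, hBV, hB, |w i|, abs_nonneg _, fun j => ?_, ?_⟩
  · by_cases hj : j ∈ B
    · simp [hj]
    · by_cases hjV : j ∈ V
      · simpa [hj] using hrest j hjV hj
      · simp [hj, hw j hjV]
  · have hm' : (0 : ℝ) < √m := Real.sqrt_pos.2 (by exact_mod_cast hm)
    rw [le_div_iff₀ hm', mul_right_comm, Real.mul_self_sqrt (by positivity)]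
    have := Finset.card_nsmul_le_sum B (fun j => |w j|) |w i| hmin
    rwa [hB, nsmul_eq_mul] at this

/-- Peel off the `m` largest entries. The sup of the remainder is at most their average, so their
`ℓ₁` mass pays for the next `√m * b`, and the sum telescopes. -/
theorem RestrictedIsometry.ellNorm_mulVec_le_of_sup_le {s d : ℝ} (h : RestrictedIsometry Φ s d)
    (hd : 0 ≤ d) {m : ℕ} (hm : 0 < m) (hms : (m : ℝ) ≤ s) (V : Finset (Fin N)) (w : Fin N → ℝ)
    (hw : ∀ i, i ∉ V → w i = 0) {b : ℝ} (hb : 0 ≤ b) (hwb : ∀ i, |w i| ≤ b) :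
    ellNorm 2 (Φ.mulVec w) ≤ √(1 + d) * (√m * b + (∑ i, |w i|) / √m) := by
  induction V using Finset.strongInduction generalizing w b with
  | H V ih =>
  rcases le_total V.card m with hVm | hmV
  · refine (h.ellNorm_mulVec_le hd (le_trans (by exact_mod_cast hVm) hms) hw).trans ?_
    gcongr
    exact (ellNorm_two_le_of_support hb hw hVm hwb).trans (le_add_of_nonneg_right (by positivity))
  · obtain ⟨B, hBV, hB, b', hb', hwb', hbB⟩ := exists_block_split hm hw hmV
    have hBne : B.Nonempty := Finset.card_pos.1 (hB ▸ hm)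
    have h1 := ih (V \ B) (Finset.sdiff_ssubset hBV hBne) (w - B.piecewise w 0)
      (fun i hi => by
        by_cases hiB : i ∈ B
        · simp [hiB]
        · have hiV : i ∉ V := fun hV => hi (Finset.mem_sdiff.2 ⟨hV, hiB⟩)
          simp [hiB, hw i hiV]) hb' hwb'
    have hBsupp : ∀ i, i ∉ B → B.piecewise w 0 i = 0 := fun i hi => by simp [hi]
    have h2 := h.ellNorm_mulVec_le hd (by rw [hB]; exact hms) hBsupp
    have h3 := ellNorm_two_le_of_support hb hBsupp hB.le fun i => by
      by_cases hi : i ∈ B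
      · simpa [hi] using hwb i
      · simpa [hi] using hb
    have h4 : Φ.mulVec w = Φ.mulVec (B.piecewise w 0) + Φ.mulVec (w - B.piecewise w 0) := by
      rw [← Matrix.mulVec_add]; congr 1; abel
    rw [h4]
    refine (ellNorm_add_le one_le_two _ _).trans ((add_le_add h2 h1).trans ?_)
    rw [(abs_sum_piecewise_add B w).2, add_div, ← mul_add]
    gcongr √(1 + d) * ?_
    linarith

/-- The first block is charged to `‖w‖₂`, all later ones to the `ℓ₁` norm of their predecessors. -/
theorem RestrictedIsometry.ellNorm_mulVec_le_add {s d : ℝ} (h : RestrictedIsometry Φ s d)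
    (hd : 0 ≤ d) {m : ℕ} (hm : 0 < m) (hms : (m : ℝ) ≤ s) (w : Fin N → ℝ) :
    ellNorm 2 (Φ.mulVec w) ≤ √(1 + d) * (ellNorm 2 w + (∑ i, |w i|) / √m) := by
  rcases le_total N m with hVm | hmV
  · refine (h.ellNorm_mulVec_le hd (V := Finset.univ) (le_trans ?_ hms) (by simp)).trans ?_
    · simpa using hVm
    · gcongr
      exact le_add_of_nonneg_right (by positivity)
  · obtain ⟨B, -, hB, b', hb', hwb', hbB⟩ := exists_block_split (V := Finset.univ) (w := w) hm
      (by simp) (by simpa using hmV)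
    have h1 := h.ellNorm_mulVec_le_of_sup_le hd hm hms Finset.univ (w - B.piecewise w 0) (by simp)
      hb' hwb'
    have h2 := h.ellNorm_mulVec_le hd (V := B) (w := B.piecewise w 0) (by rw [hB]; exact hms)
      fun i hi => by simp [hi]
    have h3 : ellNorm 2 (B.piecewise w 0) ≤ ellNorm 2 w := ellNorm_le_of_abs_le two_pos fun i => by
      by_cases hi : i ∈ B <;> simp [hi]
    have h4 : Φ.mulVec w = Φ.mulVec (B.piecewise w 0) + Φ.mulVec (w - B.piecewise w 0) := by
      rw [← Matrix.mulVec_add]; congr 1; abel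
    rw [h4]
    refine (ellNorm_add_le one_le_two _ _).trans ((add_le_add h2 h1).trans ?_)
    rw [(abs_sum_piecewise_add B w).2, add_div, ← mul_add]
    gcongr √(1 + d) * ?_
    linarith

/-- The measurement of a tail vector, under the restricted isometry property of order
`k (N / k) ^ (2 - 2 / p)`. -/
theorem RestrictedIsometry.ellNorm_mulVec_tail_le {p d b σ : ℝ} {k : ℕ} (hk : 0 < k) (hkN : k ≤ N)
    (hp : 1 ≤ p) (hp2 : p ≤ 2) (hd : 0 ≤ d)
    (h : RestrictedIsometry Φ ((k : ℝ) * ((N : ℝ) / (k : ℝ)) ^ (2 - 2 / p)) d)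
    {w : Fin N → ℝ} (hb : 0 ≤ b) (hσ : 0 ≤ σ) (hw : ∀ i, |w i| ≤ b) (hwσ : ellNorm p w ≤ σ)
    (hbσ : k * b ^ p ≤ σ ^ p) :
    ellNorm 2 (Φ.mulVec w) ≤ √(1 + d) * ((1 + √2) * ((k : ℝ) ^ (1 / 2 - 1 / p) * σ)) := by
  have hk' : (0 : ℝ) < k := by exact_mod_cast hk
  have hN' : (0 : ℝ) < N := by exact_mod_cast hk.trans_le hkN
  have hp0 : 0 < p := by linarith
  set L : ℝ := (k : ℝ) * ((N : ℝ) / (k : ℝ)) ^ (2 - 2 / p) with hL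
  have hL1 : 1 ≤ L := by
    have h1 : (1 : ℝ) ≤ (N : ℝ) / k := (one_le_div hk').2 (by exact_mod_cast hkN)
    have h2 : 0 ≤ 2 - 2 / p := by
      have : 2 / p ≤ 2 := (div_le_iff₀ hp0).2 (by linarith)
      linarith
    have h3 := Real.one_le_rpow h1 h2
    have h4 : (1 : ℝ) ≤ k := by exact_mod_cast hk
    nlinarith
  have hm : 0 < ⌊L⌋₊ := Nat.floor_pos.2 hL1
  -- Blocks have integer size; rounding `L` down costs the `√2` in `1 + √2`.
  have hmL : L ≤ 2 * (⌊L⌋₊ : ℝ) := by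
    have h1 := Nat.lt_floor_add_one L
    have h2 : (1 : ℝ) ≤ (⌊L⌋₊ : ℝ) := by exact_mod_cast hm
    linarith
  refine (h.ellNorm_mulVec_le_add hd hm (Nat.floor_le (by linarith)) w).trans ?_
  gcongr √(1 + d) * ?_
  have h2 := ellNorm_le_of_sup_le hp0 hp2 hk' hb hσ hw hwσ hbσ
  have h1 : ∑ i, |w i| ≤ (N : ℝ) ^ (1 - 1 / p) * σ := by
    rw [← ellNorm_one_eq_sum]
    refine (ellNorm_le_card_rpow_mul one_pos hp (T := Finset.univ) (c := N) (by simp)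
      (by simp)).trans ?_
    rw [one_div_one]
    gcongr
  have hsqrt : √L ≤ √2 * √(⌊L⌋₊ : ℝ) := by
    rw [← Real.sqrt_mul (by norm_num)]
    exact Real.sqrt_le_sqrt hmL
  have hm0 : 0 < √(⌊L⌋₊ : ℝ) := Real.sqrt_pos.2 (by exact_mod_cast hm)
  -- This identity dictates the value of `L`.
  have hid : (N : ℝ) ^ (1 - 1 / p) = (k : ℝ) ^ (1 / 2 - 1 / p) * √L := by
    rw [hL, Real.sqrt_eq_rpow, Real.mul_rpow (by positivity) (by positivity),
      ← Real.rpow_mul (by positivity), Real.div_rpow (by positivity) (by positivity), ← mul_assoc,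
      ← Real.rpow_add hk']
    have e1 : (2 - 2 / p) * (1 / 2) = 1 - 1 / p := by ring
    have e2 : 1 / 2 - 1 / p + 1 / 2 = 1 - 1 / p := by ring
    rw [e1, e2]
    field_simp
  have h3 : (∑ i, |w i|) / √(⌊L⌋₊ : ℝ) ≤ √2 * ((k : ℝ) ^ (1 / 2 - 1 / p) * σ) := by
    rw [div_le_iff₀ hm0]
    calc ∑ i, |w i| ≤ (k : ℝ) ^ (1 / 2 - 1 / p) * √L * σ := hid ▸ h1
      _ ≤ (k : ℝ) ^ (1 / 2 - 1 / p) * (√2 * √(⌊L⌋₊ : ℝ)) * σ := by gcongr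
      _ = √2 * ((k : ℝ) ^ (1 / 2 - 1 / p) * σ) * √(⌊L⌋₊ : ℝ) := by ring
  linarith

/-- Removing from `x` the support of `z` and the `k` largest further entries. -/
theorem exists_head_support {p : ℝ} (hp : 0 < p) {k : ℕ} (hk : 0 < k) {x z : Fin N → ℝ}
    (hz : z ∈ sparseVectors N k) :
    ∃ T : Finset (Fin N), T.card ≤ 2 * k ∧ (N < k → T = Finset.univ) ∧
      (∀ i, i ∉ T → |x i| ≤ |(x - z) i|) ∧
      ∃ b, 0 ≤ b ∧ (∀ i, i ∉ T → |x i| ≤ b) ∧ k * b ^ p ≤ ellNorm p (x - z) ^ p := by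
  set S : Finset (Fin N) := Finset.univ.filter fun i => z i ≠ 0 with hS
  have hSk : S.card ≤ k := by
    have : (hammingNorm z : ℝ) ≤ k := hz
    exact_mod_cast this
  have hzS : ∀ i, i ∉ S → z i = 0 := fun i hi => by simpa [hS] using hi
  rcases lt_or_ge Sᶜ.card k with hlt | hge
  -- Fewer than `k` indices lie off the support of `z`: keep everything, leaving no tail.
  · refine ⟨Finset.univ, ?_, fun _ => rfl, by simp, 0, le_rfl, by simp, ?_⟩
    · rw [Finset.card_univ, ← Finset.card_add_card_compl S]
      omega
    · rw [Real.zero_rpow hp.ne', mul_zero]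
      exact Real.rpow_nonneg (ellNorm_nonneg hp _) p
  · obtain ⟨B, hBS, hB, i, hi, hmin, hrest⟩ := exists_largest_subset Sᶜ (fun i => |x i|) hk hge
    refine ⟨S ∪ B, (Finset.card_union_le _ _).trans (by omega), fun hN => ?_, fun j hj => ?_, |x i|,
      abs_nonneg _, fun j hj => ?_, ?_⟩
    · have := hge.trans (Finset.card_le_univ _)
      simp at this
      omega
    · rw [Finset.mem_union, not_or] at hj
      simp [hzS j hj.1]
    · rw [Finset.mem_union, not_or] at hj
      exact hrest j (Finset.mem_compl.2 hj.1) hj.2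
    · rw [ellNorm_rpow hp]
      have h1 := Finset.card_nsmul_le_sum B (fun j => |x j| ^ p) (|x i| ^ p) fun j hj =>
        Real.rpow_le_rpow (abs_nonneg _) (hmin j hj) hp.le
      rw [hB, nsmul_eq_mul] at h1
      refine h1.trans (le_trans (le_of_eq ?_) (Finset.sum_le_sum_of_subset_of_nonneg
        (Finset.subset_univ B) fun j _ _ => by positivity))
      refine Finset.sum_congr rfl fun j hj => ?_
      rw [Pi.sub_apply, hzS j (Finset.mem_compl.1 (hBS hj)), sub_zero]

end Tail

/-! ### Assembling the recovery estimate. -/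

section Recovery

variable {n N : ℕ} {Φ : Matrix (Fin n) (Fin N) ℝ}

theorem le_ompAlpha (δ : ℝ) : 16 + 15 * δ ≤ (ompAlpha δ : ℝ) := Nat.le_ceil _

/-- Recovery of a `2k`-sparse vector `u` from noisy measurements. -/
theorem omp_sparse_recovery {k : ℕ} (hk : 0 < k) {δ : ℝ} (hδ0 : 0 < δ) (hδ1 : δ ≤ 1)
    (hRIP : ripConst Φ (2 * (k : ℝ)) +
      (1 + δ) * ripConst Φ (2 * (ompAlpha δ : ℝ) * (k : ℝ)) ≤ δ)
    {u : Fin N → ℝ} {S : Finset (Fin N)} (hu : ∀ i, i ∉ S → u i = 0) (hS : S.card ≤ 2 * k)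
    {e : Fin n → ℝ} {xs : Fin N → ℝ}
    (hxs : IsOMPOutput Φ (2 * (ompAlpha δ - 1) * k) (Φ.mulVec u + e) xs) :
    ellNorm 2 (xs - u) ≤ √(1 + δ) * ((√11 + 1) * ellNorm 2 e) ∧
      ∃ T : Finset (Fin N), (∀ i, i ∉ T → (xs - u) i = 0) ∧
        (T.card : ℝ) ≤ 2 * (ompAlpha δ : ℝ) * (k : ℝ) := by
  obtain ⟨Λ', hstate⟩ := hxs
  obtain ⟨Λ, c, hrun, rfl, rfl⟩ := hstate.exists_run
  set M := 2 * (ompAlpha δ - 1) * k with hM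
  have hα := le_ompAlpha δ
  have hα1 : 1 ≤ ompAlpha δ := by
    have : (1 : ℝ) ≤ (ompAlpha δ : ℝ) := by linarith
    exact_mod_cast this
  have hαA : ((ompAlpha δ - 1 : ℕ) : ℝ) = (ompAlpha δ : ℝ) - 1 := by simp [hα1]
  have hk1 : (1 : ℝ) ≤ k := by exact_mod_cast hk
  obtain ⟨hd1, hrip1⟩ := restrictedIsometry_ripConst Φ (2 * (k : ℝ))
  obtain ⟨hd2, hrip2⟩ := restrictedIsometry_ripConst Φ (2 * (ompAlpha δ : ℝ) * (k : ℝ))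
  set d1 := ripConst Φ (2 * (k : ℝ))
  set d2 := ripConst Φ (2 * (ompAlpha δ : ℝ) * (k : ℝ))
  simp only [RestrictedIsometry, ellNorm_two_sq] at hrip1 hrip2
  -- The hypothesis rearranged: the ratio of upper to lower isometry bounds is at most `κ = 1 + δ`.
  -- It also yields `1 / (1 - d2) ≤ 1 + δ`.
  have hκ : 1 + d1 ≤ (1 + δ) * (1 - d2) := by linarith
  have hlo : 0 < 1 - d2 :=
    pos_of_mul_pos_right (lt_of_lt_of_le (by linarith) hκ) (show 0 ≤ 1 + δ by linarith)
  have hcard : ((S ∪ Λ M).card : ℝ) ≤ 2 * (ompAlpha δ : ℝ) * (k : ℝ) := by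
    have h1 : (S ∪ Λ M).card ≤ 2 * k + M :=
      (Finset.card_union_le _ _).trans (add_le_add hS (hrun.card_le le_rfl))
    have h2 : ((S ∪ Λ M).card : ℝ) ≤ 2 * k + 2 * ((ompAlpha δ - 1 : ℕ) : ℝ) * k := by
      exact_mod_cast h1
    rw [hαA] at h2
    linarith
  have hlower : ∀ v : Fin N → ℝ, (∀ i, i ∉ S → i ∉ Λ M → v i = 0) →
      (1 - d2) * (v ⬝ᵥ v) ≤ Φ.mulVec v ⬝ᵥ Φ.mulVec v := fun v hv =>
    (hrip2 v (mem_sparseVectors_of_support (S ∪ Λ M) (fun i hi => by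
      rw [Finset.mem_union, not_or] at hi
      exact hv i hi.1 hi.2) hcard)).1
  have hQ : residualEnergy Φ (Φ.mulVec u + e) (c M) ≤ 11 * (e ⬝ᵥ e) := by
    refine hrun.residualEnergy_le_of_missing hu hlo (by linarith) hκ (by linarith)
      (A := ompAlpha δ - 1) (by rw [hαA]; linarith) (fun j a => ?_) (fun v hv => ?_) hlower
      _ 0 rfl ?_
    · have h1 := (hrip1 (Pi.single j a) (mem_sparseVectors_of_support {j} (fun i hi => by
        rw [Finset.mem_singleton] at hi
        simp [hi]) (by simp; linarith))).2
      rwa [dotProduct_single, Pi.single_eq_same, ← sq] at h1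
    · exact (hrip1 v (mem_sparseVectors_of_support S hv (by exact_mod_cast hS))).2
    · rw [hrun.zero, Finset.sdiff_empty, zero_add, hM]
      calc (ompAlpha δ - 1) * S.card ≤ (ompAlpha δ - 1) * (2 * k) := Nat.mul_le_mul_left _ hS
        _ = 2 * (ompAlpha δ - 1) * k := by ring
  have hsupp : ∀ i, i ∉ S → i ∉ Λ M → (c M - u) i = 0 := fun i hi hi' => by
    rw [Pi.sub_apply, hu i hi, hrun.supported M le_rfl i hi', sub_zero]
  refine ⟨?_, S ∪ Λ M, fun i hi => ?_, hcard⟩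
  · have he := ellNorm_nonneg two_pos e
    have h1 : ellNorm 2 (-(Φ.mulVec u + e - Φ.mulVec (c M))) ≤ √11 * ellNorm 2 e := by
      refine ellNorm_two_le_of_dotProduct_le (by positivity) ?_
      rw [neg_dotProduct_neg, mul_pow, Real.sq_sqrt (by norm_num), ellNorm_two_sq]
      exact hQ
    have h2 : Φ.mulVec (c M - u) = -(Φ.mulVec u + e - Φ.mulVec (c M)) + e := by
      rw [Matrix.mulVec_sub]; abel
    have h3 : ellNorm 2 (Φ.mulVec (c M - u)) ≤ (√11 + 1) * ellNorm 2 e := by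
      rw [h2]
      refine (ellNorm_add_le one_le_two _ _).trans ?_
      linarith
    refine ellNorm_two_le_of_dotProduct_le (by positivity) ?_
    rw [mul_pow, Real.sq_sqrt (by linarith)]
    have h4 := hlower _ hsupp
    rw [← ellNorm_two_sq (Φ.mulVec _)] at h4
    have h5 := pow_le_pow_left₀ (ellNorm_nonneg two_pos _) h3 2
    have h6 := dotProduct_self_nonneg_real (c M - u)
    calc (c M - u) ⬝ᵥ (c M - u) ≤ ((1 + δ) * (1 - d2)) * ((c M - u) ⬝ᵥ (c M - u)) :=
          le_mul_of_one_le_left h6 (by linarith)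
      _ = (1 + δ) * ((1 - d2) * ((c M - u) ⬝ᵥ (c M - u))) := by ring
      _ ≤ (1 + δ) * ((√11 + 1) * ellNorm 2 e) ^ 2 := by
          gcongr
          exact h4.trans h5
  · rw [Finset.mem_union, not_or] at hi
    exact hsupp i hi.1 hi.2

/-- The residual constant `11` does not grow with `δ`; the slack against `11 + 20 * δ`, and the
additive `2`, absorb the excess of `1 + √2` over `2`. -/
theorem recovery_constant_le {δ : ℝ} (hδ0 : 0 < δ) (hδ1 : δ ≤ 1) :
    (1 + δ) * (√11 + 1) * (1 + √2) ≤ 2 * (1 + δ) * (√(11 + 20 * δ) + 1) + 2 := by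
  have h11 : √11 ≤ 3.317 := Real.sqrt_le_iff.2 (by norm_num)
  have h2 : √2 ≤ 1.4143 := Real.sqrt_le_iff.2 (by norm_num)
  have h11' : 0 ≤ √11 := Real.sqrt_nonneg _
  have hs : √11 + 2.2 * δ ≤ √(11 + 20 * δ) := by
    refine Real.le_sqrt_of_sq_le ?_
    have h3 : √11 ^ 2 = 11 := Real.sq_sqrt (by norm_num)
    nlinarith
  have h4 : (√11 + 1) * (√2 - 1) ≤ 4.317 * 0.4143 := by
    have : 1 ≤ √2 := Real.one_le_sqrt.2 (by norm_num)
    exact mul_le_mul (by linarith) (by linarith) (by linarith) (by norm_num)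
  have h5 := mul_le_mul_of_nonneg_left h4 (show 0 ≤ 1 + δ by linarith)
  have h6 := mul_le_mul_of_nonneg_left hs (show 0 ≤ 2 * (1 + δ) by linarith)
  nlinarith

/-- The recovery estimate with an arbitrary `k`-sparse competitor `z`. -/
theorem omp_recovery_of_sparse_competitor {k : ℕ} (hk : 0 < k) {p q δ : ℝ}
    (hp : 1 ≤ p) (hpq : p ≤ q) (hq : q ≤ 2) (hδ0 : 0 < δ) (hδ1 : δ ≤ 1)
    (hL : RestrictedIsometry Φ ((k : ℝ) * ((N : ℝ) / (k : ℝ)) ^ (2 - 2 / p)) δ)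
    (hRIP : ripConst Φ (2 * (k : ℝ)) +
      (1 + δ) * ripConst Φ (2 * (ompAlpha δ : ℝ) * (k : ℝ)) ≤ δ)
    {x z xs : Fin N → ℝ} {e : Fin n → ℝ} {ε : ℝ} (he : ellNorm 2 e ≤ ε)
    (hxs : IsOMPOutput Φ (2 * (ompAlpha δ - 1) * k) (Φ.mulVec x + e) xs)
    (hz : z ∈ sparseVectors N k) :
    ellNorm q (xs - x) ≤
      ompC0 δ q * (ellNorm p (x - z) / (k : ℝ) ^ (1 / p - 1 / q)) +
        ompC1 δ q * (k : ℝ) ^ (1 / q - 1 / 2) * ε := by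
  have hp0 : 0 < p := by linarith
  have hq1 : 1 ≤ q := hp.trans hpq
  have hq0 : 0 < q := by linarith
  have hk' : (0 : ℝ) < k := by exact_mod_cast hk
  have hε : 0 ≤ ε := (ellNorm_nonneg two_pos e).trans he
  obtain ⟨T, hT, hTuniv, hTz, b, hb, hTb, hbσ⟩ := exists_head_support hp0 hk (x := x) hz
  set σ := ellNorm p (x - z) with hσ
  have hσ0 : 0 ≤ σ := ellNorm_nonneg hp0 _
  set u : Fin N → ℝ := T.piecewise x 0 with hu
  set w : Fin N → ℝ := x - u with hw
  have huT : ∀ i, i ∉ T → u i = 0 := fun i hi => by simp [hu, hi]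
  have hwT : ∀ i, i ∈ T → w i = 0 := fun i hi => by simp [hw, hu, hi]
  have hwx : ∀ i, i ∉ T → w i = x i := fun i hi => by simp [hw, hu, hi]
  have hwb : ∀ i, |w i| ≤ b := fun i => by
    by_cases hi : i ∈ T
    · simpa [hwT i hi] using hb
    · simpa [hwx i hi] using hTb i hi
  have hwσ : ellNorm p w ≤ σ := ellNorm_le_of_abs_le hp0 fun i => by
    by_cases hi : i ∈ T
    · simp [hwT i hi]
    · simpa [hwx i hi] using hTz i hi
  set K := (k : ℝ) ^ (1 / q - 1 / p) * σ with hK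
  have hwq : ellNorm q w ≤ K := ellNorm_le_of_sup_le hp0 hpq hk' hb hσ0 hwb hwσ hbσ
  have hΦw : ellNorm 2 (Φ.mulVec w) ≤
      √(1 + δ) * ((1 + √2) * ((k : ℝ) ^ (1 / 2 - 1 / p) * σ)) := by
    -- The tail estimate needs `N / k ≥ 1`; for `N < k` the tail is zero.
    rcases lt_or_ge N k with hlt | hge
    · have hw0 : w = 0 := funext fun i => hwT i (by simp [hTuniv hlt])
      have h0 : ellNorm 2 (Φ.mulVec w) ≤ 0 :=
        ellNorm_two_le_of_dotProduct_le le_rfl (by simp [hw0])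
      exact h0.trans (by positivity)
    · exact hL.ellNorm_mulVec_tail_le hk hge hp (hpq.trans hq) hδ0.le hb hσ0 hwb hwσ hbσ
  have hy : Φ.mulVec x + e = Φ.mulVec u + (Φ.mulVec w + e) := by
    rw [← add_assoc, ← Matrix.mulVec_add, hw, add_sub_cancel]
  rw [hy] at hxs
  obtain ⟨hrec, V, hV, hVcard⟩ := omp_sparse_recovery hk hδ0 hδ1 hRIP huT hT hxs
  set P := (2 * (ompAlpha δ : ℝ)) ^ (1 / q - 1 / 2) with hP
  have hP0 : 0 ≤ P := by positivity
  set Kε := (k : ℝ) ^ (1 / q - 1 / 2) with hKε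
  have hKε0 : 0 ≤ Kε := by positivity
  have hK0 : 0 ≤ K := by positivity
  have hsum : ellNorm 2 (Φ.mulVec w + e) ≤
      √(1 + δ) * ((1 + √2) * ((k : ℝ) ^ (1 / 2 - 1 / p) * σ)) + ε :=
    (ellNorm_add_le one_le_two _ _).trans (add_le_add hΦw he)
  have hKK : Kε * ((k : ℝ) ^ (1 / 2 - 1 / p) * σ) = K := by
    rw [hK, hKε, ← mul_assoc, ← Real.rpow_add hk']
    congr 2
    ring
  have hκ : √(1 + δ) * √(1 + δ) = 1 + δ := Real.mul_self_sqrt (by linarith)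
  have hmain : ellNorm q (xs - u) ≤ P * ((1 + δ) * (√11 + 1) * (1 + √2)) * K +
      P * (√(1 + δ) * (√11 + 1)) * Kε * ε := by
    calc ellNorm q (xs - u) ≤ (2 * (ompAlpha δ : ℝ) * k) ^ (1 / q - 1 / 2) * ellNorm 2 (xs - u) :=
          ellNorm_le_card_rpow_mul hq0 hq hV hVcard
      _ ≤ P * Kε * (√(1 + δ) * ((√11 + 1) *
            (√(1 + δ) * ((1 + √2) * ((k : ℝ) ^ (1 / 2 - 1 / p) * σ)) + ε))) := by
          rw [Real.mul_rpow (by positivity) hk'.le]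
          refine mul_le_mul_of_nonneg_left (hrec.trans ?_) (by positivity)
          gcongr
      _ = P * ((√(1 + δ) * √(1 + δ)) * (√11 + 1) * (1 + √2)) *
            (Kε * ((k : ℝ) ^ (1 / 2 - 1 / p) * σ)) +
            P * (√(1 + δ) * (√11 + 1)) * Kε * ε := by ring
      _ = _ := by rw [hκ, hKK]
  have htri : ellNorm q (xs - x) ≤ ellNorm q (xs - u) + K := by
    have h1 : xs - x = (xs - u) + -w := by rw [hw]; abel
    rw [h1]
    refine (ellNorm_add_le hq1 _ _).trans (add_le_add le_rfl ?_)
    exact (ellNorm_le_of_abs_le hq0 fun i => by simp).trans hwq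
  have hdiv : σ / (k : ℝ) ^ (1 / p - 1 / q) = K := by
    rw [hK, div_eq_inv_mul, ← Real.rpow_neg hk'.le, neg_sub]
  have hc1 : P * ((1 + δ) * (√11 + 1) * (1 + √2)) ≤ ompC1 δ q + P := by
    have h1 := mul_le_mul_of_nonneg_left (recovery_constant_le hδ0 hδ1) hP0
    rw [ompC1, ← hP]
    linarith
  have hc2 : P * (√(1 + δ) * (√11 + 1)) ≤ ompC1 δ q := by
    rw [ompC1, ← hP]
    refine mul_le_mul_of_nonneg_left ?_ hP0
    have h1 : √(1 + δ) ≤ 1 + δ := Real.sqrt_le_iff.2 ⟨by linarith, by nlinarith⟩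
    have h2 : √11 ≤ √(11 + 20 * δ) := Real.sqrt_le_sqrt (by linarith)
    have h3 : √(1 + δ) * (√11 + 1) ≤ (1 + δ) * (√(11 + 20 * δ) + 1) := by gcongr
    have h4 : 0 ≤ (1 + δ) * (√(11 + 20 * δ) + 1) := by positivity
    linarith
  have h1 := mul_le_mul_of_nonneg_right hc1 hK0
  have h2 := mul_le_mul_of_nonneg_right (mul_le_mul_of_nonneg_right hc2 hKε0) hε
  rw [hdiv, ompC0, ← hP]
  linarith

end Recovery

theorem theorem1 {n N k : ℕ} (hk : 0 < k) (p q δ : ℝ)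
    (hp : 1 ≤ p) (hpq : p ≤ q) (hq : q ≤ 2) (hp2 : p ≠ 2) (hδ0 : 0 < δ) (hδ1 : δ ≤ 1)
    (Φ : Matrix (Fin n) (Fin N) ℝ)
    (hL : RIP Φ ((k : ℝ) * ((N : ℝ) / (k : ℝ)) ^ (2 - 2 / p)) δ)
    (hRIP : ripConst Φ (2 * (k : ℝ)) +
      (1 + δ) * ripConst Φ (2 * (ompAlpha δ : ℝ) * (k : ℝ)) ≤ δ)
    (x : Fin N → ℝ) (e : Fin n → ℝ) (ε : ℝ) (he : ellNorm 2 e ≤ ε)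
    (xs : Fin N → ℝ)
    (hxs : IsOMPOutput Φ (2 * (ompAlpha δ - 1) * k) (Φ.mulVec x + e) xs) :
    ellNorm q (xs - x) ≤
      ompC0 δ q * (bestTermError p k x / (k : ℝ) ^ (1 / p - 1 / q)) +
        ompC1 δ q * (k : ℝ) ^ (1 / q - 1 / 2) * ε := by
  have hk' : (0 : ℝ) < k := by exact_mod_cast hk
  have hL' : RestrictedIsometry Φ ((k : ℝ) * ((N : ℝ) / (k : ℝ)) ^ (2 - 2 / p)) δ := by
    intro v hv
    have h1 := (restrictedIsometry_ripConst Φ _).2 v hv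
    have h2 : ripConst Φ ((k : ℝ) * ((N : ℝ) / (k : ℝ)) ^ (2 - 2 / p)) ≤ δ := le_of_lt hL
    have h3 := mul_le_mul_of_nonneg_right h2 (sq_nonneg (ellNorm 2 v))
    exact ⟨by linarith [h1.1], by linarith [h1.2]⟩
  set a := (k : ℝ) ^ (1 / p - 1 / q) with ha
  have ha0 : 0 < a := by positivity
  have hC1 : 0 ≤ ompC1 δ q := by unfold ompC1; positivity
  have hC0 : 0 < ompC0 δ q := by unfold ompC0; positivity
  set R := ompC1 δ q * (k : ℝ) ^ (1 / q - 1 / 2) * ε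
  -- Solving the estimate for the competitor's error gives a lower bound uniform in `z`, which
  -- passes to the infimum without a minimizer.
  have hinf : (ellNorm q (xs - x) - R) / ompC0 δ q * a ≤ bestTermError p k x := by
    refine le_csInf ⟨_, 0, ?_, rfl⟩ ?_
    · simp [sparseVectors]
    · rintro _ ⟨z, hz, rfl⟩
      have h1 := omp_recovery_of_sparse_competitor hk hp hpq hq hδ0 hδ1 hL' hRIP he hxs hz
      rw [← le_div_iff₀ ha0, div_le_iff₀ hC0]
      linarith
  rw [← le_div_iff₀ ha0, div_le_iff₀ hC0] at hinf
  linarith
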